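/- Let $X\in\mathbb{R}^{n\times p}$ have nonzero columns $X_1,\dots,X_p$ in general position, i.e. for every $m\le\min\{n,p\}$, all distinct indices $i_1,\dots,i_m$ and all signs $s_1,\dots,s_m\in\{-1,1\}$, the affine span of $s_1X_{i_1},\dots,s_mX_{i_m}$ contains none of the vectors $\pm X_i$ with $i\notin\{i_1,\dots,i_m\}$. Let $\lambda>0$. For $y\in\mathbb{R}^n$ consider the lasso problem $$\min_{w\in\mathbb{R}^p}\ \tfrac12\|y-Xw\|_2^2+\lambda\|w\|_1 ,$$ and cyclic coordinate descent for it: from a starting point $w^{(0)}\in\mathbb{R}^p$ (for instance $w^{(0)}=0$), for $k=1,2,\dots$ and $i=1,\dots,p$, $$w_i^{(k)}=\mathop{\mathrm{argmin}}_{t\in\mathbb{R}}\ \tfrac12\Big\|y-\sum_{j<i}X_jw_j^{(k)}-\sum_{j>i}X_jw_j^{(k-1)}-tX_i\Big\|_2^2+\lambda|t| .$$ For every $y$ the lasso solution $\hat w$ exists and is unique, and the iterates are well defined for every starting point. For (Lebesgue) almost every $y\in\mathbb{R}^n$, $$\{i: |X_i^T(y-X\hat w)|=\lambda\}=\mathrm{supp}(\hat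 w). \qquad (*)$$ For every $y$ satisfying $(*)$ and every starting point, writing $A=\mathrm{supp}(\hat w)=\{i_1<\dots<i_a\}$ and $\|z\|_\Sigma^2=z^TX^TXz$, we have for all sufficiently large $k$ $$\|w^{(k+1)}-\hat w\|_\Sigma\ \le\ \Bigg(1-\prod_{j=1}^{a-1}\frac{\|P^\perp_{\{i_{j+1},\dots,i_a\}}X_{i_j}\|_2^2}{\|X_{i_j}\|_2^2}\Bigg)^{1/2}\|w^{(k)}-\hat w\|_\Sigma ,$$ where $P^\perp_{S}$ is the orthogonal projection onto the orthocomplement of $\mathrm{span}\{X_i:i\in S\}$ and an empty product is $1$. In particular, for almost every $y$, whenever the denominator is nonzero the ratio $\|w^{(k+1)}-\hat w\|_\Sigma/\|w^{(k)}-\hat w\|_\Sigma$ is at most this constant for all sufficiently large $k$. -/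

import Mathlib

open Filter MeasureTheory

noncomputable section

namespace LassoCD

variable {n p : ℕ}

/-- The `i`-th column `X_i` of `X`, as a vector of Euclidean space. -/
def column (X : Matrix (Fin n) (Fin p) ℝ) (i : Fin p) : EuclideanSpace ℝ (Fin n) :=
  WithLp.toLp 2 (fun r => X r i)

/-- The columns of `X` are in general position: for every choice of signs and every `m`
with `m ≤ min n p`, the affine span of `m` of the signed columns contains none of the other
columns or their negatives (`σ` runs over all sign choices, so both signs of `X_i` are
covered). -/
def GeneralPosition (X : Matrix (Fin n) (Fin p) ℝ) : Prop :=
  ∀ σ : Fin p → ℝ, (∀ i, σ i = 1 ∨ σ i = -1) →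
    ∀ S : Finset (Fin p), S.card ≤ min n p →
      ∀ i ∉ S, σ i • column X i ∉
        affineSpan ℝ ((fun j => σ j • column X j) '' (S : Set (Fin p)))

/-- The fitted vector `X w`. -/
def fit (X : Matrix (Fin n) (Fin p) ℝ) (w : Fin p → ℝ) : EuclideanSpace ℝ (Fin n) :=
  WithLp.toLp 2 (X.mulVec w)

/-- The lasso objective `(1/2) ‖y - X w‖₂² + lam ‖w‖₁`. -/
def lassoObjective (X : Matrix (Fin n) (Fin p) ℝ) (y : EuclideanSpace ℝ (Fin n)) (lam : ℝ)
    (w : Fin p → ℝ) : ℝ :=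
  (1 / 2) * ‖y - fit X w‖ ^ 2 + lam * ∑ i, |w i|

/-- `w` is a minimizer of the lasso objective over `ℝ^p`. -/
def IsLassoSolution (X : Matrix (Fin n) (Fin p) ℝ) (y : EuclideanSpace ℝ (Fin n)) (lam : ℝ)
    (w : Fin p → ℝ) : Prop :=
  ∀ v : Fin p → ℝ, lassoObjective X y lam w ≤ lassoObjective X y lam v

/-- The objective of the update of coordinate `i`, as a function of the new value `t`: the
coordinates below `i` have their new values `v`, those above `i` their old values `u`. -/
def coordinateObjective (X : Matrix (Fin n) (Fin p) ℝ) (y : EuclideanSpace ℝ (Fin n))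
    (lam : ℝ) (v u : Fin p → ℝ) (i : Fin p) (t : ℝ) : ℝ :=
  (1 / 2) * ‖y - ∑ j ∈ Finset.Iio i, v j • column X j
      - ∑ j ∈ Finset.Ioi i, u j • column X j - t • column X i‖ ^ 2 + lam * |t|

/-- `w 0, w 1, w 2, …` are the iterates of cyclic coordinate descent with exact coordinatewise
minimization (one step is a full cycle over the coordinates `1, …, p`), started at `w 0`. -/
def IsCoordinateDescent (X : Matrix (Fin n) (Fin p) ℝ) (y : EuclideanSpace ℝ (Fin n))
    (lam : ℝ) (w : ℕ → Fin p → ℝ) : Prop :=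
  ∀ (k : ℕ) (i : Fin p) (t : ℝ),
    coordinateObjective X y lam (w (k + 1)) (w k) i (w (k + 1) i) ≤
      coordinateObjective X y lam (w (k + 1)) (w k) i t

/-- The support (active set) of a coefficient vector. -/
def activeSet (w : Fin p → ℝ) : Finset (Fin p) :=
  Finset.univ.filter (fun i => w i ≠ 0)

/-- The equicorrelation set `{i : |X_iᵀ (y - X w)| = lam}`. -/
def equicorrelationSet (X : Matrix (Fin n) (Fin p) ℝ) (y : EuclideanSpace ℝ (Fin n))
    (lam : ℝ) (w : Fin p → ℝ) : Finset (Fin p) :=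
  Finset.univ.filter (fun i => |inner ℝ (column X i) (y - fit X w)| = lam)

/-- `‖z‖_Σ = (zᵀ Σ z)^(1/2)` with `Σ = Xᵀ X`. -/
def sigmaNorm (X : Matrix (Fin n) (Fin p) ℝ) (z : Fin p → ℝ) : ℝ :=
  Real.sqrt (z ⬝ᵥ (X.transpose * X).mulVec z)

/-- `P_S^⊥ v`: projection of `v` onto the orthocomplement of the span of the columns indexed
by `S`. -/
def orthProj (X : Matrix (Fin n) (Fin p) ℝ) (S : Finset (Fin p))
    (v : EuclideanSpace ℝ (Fin n)) : EuclideanSpace ℝ (Fin n) :=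
  (Submodule.span ℝ (column X '' (S : Set (Fin p))))ᗮ.starProjection v

/-- With `A = {i_1 < ⋯ < i_a}`, the number
`(1 - ∏_{j=1}^{a-1} ‖P^⊥_{i_{j+1},…,i_a} X_{i_j}‖² / ‖X_{i_j}‖²)^(1/2)`. The product runs over
the elements `i` of `A` other than the largest one, and the elements of `A` that follow `i` are
those `l ∈ A` with `i < l`. -/
def rateBound (X : Matrix (Fin n) (Fin p) ℝ) (A : Finset (Fin p)) : ℝ :=
  Real.sqrt (1 - ∏ i ∈ A.filter (fun i => ∃ l ∈ A, i < l),
    ‖orthProj X (A.filter (fun l => i < l)) (column X i)‖ ^ 2 / ‖column X i‖ ^ 2)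

end LassoCD

end

/-!
The proof rests on the Karush–Kuhn–Tucker conditions, written throughout as the pair
`|g| ≤ lam`, `w g = lam |w|` for a coefficient `w` and the correlation `g` of its column with the
residual; this pair says that `g` is a subgradient of `lam |·|` at `w`.

*Uniqueness.* By strict convexity in the fit, all solutions have the same residual `r`. The columns
with `|⟪X_i, r⟫| = lam` are linearly independent: after a change of signs they all have inner
product `lam` with `r`, so a linear relation between them expresses one as an affine combination of
others, against general position (`linearIndepOn_column`).

*Almost every response.* If `i` is in the equicorrelation set but not in the support `S` of the
solution, then the inner product of `y` with `P_S^⊥ X_i ≠ 0` depends only on `S`, `i` and finitely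
many signs, so `y` lies in one of finitely many hyperplanes (`ae_inner_column_ne`).

*Convergence.* Each coordinate update decreases the objective by at least half the squared change of
the fit, so the changes tend to zero. The end of a cycle therefore satisfies the optimality
conditions up to a vanishing error, and convexity gives convergence of the fits to the optimal one
(`IsCoordinateDescent.tendsto_fit`). Coordinates outside the equicorrelation set are then eventually
set to zero, and on the equicorrelation set, where the columns are independent, the coefficients
converge, so that support and signs are identified after finitely many cycles.

*Rate.* From then on a cycle acts on the error of the fit as the product of the orthogonal
projections onto `X_i^⊥`, `i` in the support in increasing order. The estimate of Smith, Solmon and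
Wagner for such products (`norm_sq_le_of_successive_projections`) gives the stated factor. It is
proved in the form `‖T u‖² ≤ ‖u‖² - c ‖P u‖²`, where `P` projects onto the span of the columns
involved; this form is inductive without splitting `u`.
-/

namespace LassoCD

variable {n p : ℕ}

local notation "⟪" a ", " b "⟫" => inner ℝ a b

/-! ### Scalar subproblem -/

theorem norm_sub_smul_sq {E : Type*} [NormedAddCommGroup E] [InnerProductSpace ℝ E]
    (a x : E) (d : ℝ) : ‖a - d • x‖ ^ 2 = ‖a‖ ^ 2 - 2 * (d * ⟪x, a⟫) + d ^ 2 * ‖x‖ ^ 2 := by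
  rw [norm_sub_sq_real, inner_smul_right, norm_smul, mul_pow, Real.norm_eq_abs, sq_abs,
    real_inner_comm]

/-- Two-point comparison for the scalar problem `s ↦ ½ ‖b - s x‖² + lam |s|`: a point satisfying the
subgradient condition is beaten by every other point by a quadratic margin. -/
theorem scalar_lower_bound {E : Type*} [NormedAddCommGroup E] [InnerProductSpace ℝ E]
    {b x : E} {lam t : ℝ} (h₁ : |⟪x, b - t • x⟫| ≤ lam)
    (h₂ : t * ⟪x, b - t • x⟫ = lam * |t|) (s : ℝ) :
    (1 / 2) * ‖b - t • x‖ ^ 2 + lam * |t| + (1 / 2) * ((s - t) ^ 2 * ‖x‖ ^ 2) ≤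
      (1 / 2) * ‖b - s • x‖ ^ 2 + lam * |s| := by
  have e : b - s • x = (b - t • x) - (s - t) • x := by module
  have h3 : s * ⟪x, b - t • x⟫ ≤ lam * |s| :=
    calc s * ⟪x, b - t • x⟫ ≤ |s * ⟪x, b - t • x⟫| := le_abs_self _
      _ = |⟪x, b - t • x⟫| * |s| := by rw [abs_mul, mul_comm]
      _ ≤ lam * |s| := by gcongr
  rw [e, norm_sub_smul_sq (b - t • x)]
  linarith

theorem nonneg_of_forall_quadratic {a c : ℝ}
    (h : ∀ ε : ℝ, 0 < ε → 0 ≤ ε * a + ε ^ 2 * c) : 0 ≤ a := by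
  by_contra! ha
  have h1 : 0 < |c| + 1 := by positivity
  have hε : 0 < -a / (|c| + 1) := div_pos (by linarith) h1
  have := h _ hε
  have h2 : 0 ≤ a + (-a / (|c| + 1)) * c := by
    by_contra! h3
    nlinarith
  have h4 : (-a / (|c| + 1)) * c < -a := by
    calc (-a / (|c| + 1)) * c ≤ (-a / (|c| + 1)) * |c| := by gcongr; exact le_abs_self c
      _ < (-a / (|c| + 1)) * (|c| + 1) := by gcongr; linarith
      _ = -a := by field_simp
  linarith

/-- Optimality in the scalar problem, written without subdifferentials: the condition
`⟪x, b - t x⟫ ∈ lam ∂|·|(t)` amounts to `|⟪x, b - t x⟫| ≤ lam` and `t ⟪x, b - t x⟫ = lam |t|`. -/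
theorem scalar_isMin_iff {E : Type*} [NormedAddCommGroup E] [InnerProductSpace ℝ E]
    {b x : E} {lam t : ℝ} (hlam : 0 ≤ lam) :
    (∀ s : ℝ, (1 / 2) * ‖b - t • x‖ ^ 2 + lam * |t| ≤ (1 / 2) * ‖b - s • x‖ ^ 2 + lam * |s|) ↔
      |⟪x, b - t • x⟫| ≤ lam ∧ t * ⟪x, b - t • x⟫ = lam * |t| := by
  constructor
  · intro h
    set g := ⟪x, b - t • x⟫ with hg
    have key : ∀ d : ℝ, 0 ≤ -d * g + (1 / 2) * (d ^ 2 * ‖x‖ ^ 2) + lam * (|t + d| - |t|) := by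
      intro d
      have h1 := h (t + d)
      have e : b - (t + d) • x = (b - t • x) - d • x := by module
      rw [e, norm_sub_smul_sq (b - t • x), ← hg] at h1
      linarith
    have hb : ∀ σ : ℝ, |σ| = 1 → σ * g ≤ lam := by
      intro σ hσ
      have : 0 ≤ lam - σ * g := by
        refine nonneg_of_forall_quadratic (c := (1 / 2) * ‖x‖ ^ 2) fun ε hε => ?_
        have h1 := key (ε * σ)
        have h2 : |t + ε * σ| - |t| ≤ ε := by
          have := abs_add_le t (ε * σ)
          rw [abs_mul, hσ, abs_of_pos hε] at this
          linarith
        have h3 : lam * (|t + ε * σ| - |t|) ≤ lam * ε := by gcongr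
        have h4 : σ ^ 2 = 1 := by rw [← sq_abs, hσ]; norm_num
        rw [mul_pow, h4] at h1
        linarith
      linarith
    refine ⟨abs_le.2 ⟨?_, ?_⟩, le_antisymm ?_ ?_⟩
    · have := hb (-1) (by norm_num)
      linarith
    · have := hb 1 (by norm_num)
      linarith
    · calc t * g ≤ |t * g| := le_abs_self _
        _ = |g| * |t| := by rw [abs_mul, mul_comm]
        _ ≤ lam * |t| := by
          gcongr
          refine abs_le.2 ⟨?_, ?_⟩
          · have := hb (-1) (by norm_num)
            linarith
          · have := hb 1 (by norm_num)
            linarith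
    · -- shrink `t` towards `0`; a step of relative size `ε / (1 + ε)` stays on the same side of `0`
      have : 0 ≤ t * g - lam * |t| := by
        refine nonneg_of_forall_quadratic (c := (1 / 2) * (t ^ 2 * ‖x‖ ^ 2) + (t * g - lam * |t|))
          fun ε hε => ?_
        have h1 := key (-(ε / (1 + ε)) * t)
        have h2 : t + -(ε / (1 + ε)) * t = (1 / (1 + ε)) * t := by field_simp; ring
        have h3 : (0 : ℝ) < 1 / (1 + ε) := by positivity
        rw [h2, abs_mul, abs_of_pos h3] at h1
        have h4 : -(-(ε / (1 + ε)) * t) * g + (1 / 2) * ((-(ε / (1 + ε)) * t) ^ 2 * ‖x‖ ^ 2) +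
            lam * (1 / (1 + ε) * |t| - |t|) = (1 / (1 + ε)) ^ 2 *
            (ε * (t * g - lam * |t|) +
              ε ^ 2 * ((1 / 2) * (t ^ 2 * ‖x‖ ^ 2) + (t * g - lam * |t|))) := by
          field_simp; ring
        rw [h4] at h1
        exact nonneg_of_mul_nonneg_right h1 (by positivity)
      linarith
  · rintro ⟨h₁, h₂⟩ s
    have := scalar_lower_bound h₁ h₂ s
    have : 0 ≤ (1 / 2) * ((s - t) ^ 2 * ‖x‖ ^ 2) := by positivity
    linarith

/-- The minimizer is the soft-thresholded least squares coefficient. -/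
theorem scalar_existsUnique {E : Type*} [NormedAddCommGroup E] [InnerProductSpace ℝ E]
    (b : E) {x : E} (hx : x ≠ 0) {lam : ℝ} (hlam : 0 < lam) :
    ∃! t : ℝ, ∀ s : ℝ,
      (1 / 2) * ‖b - t • x‖ ^ 2 + lam * |t| ≤ (1 / 2) * ‖b - s • x‖ ^ 2 + lam * |s| := by
  have hx2 : 0 < ‖x‖ ^ 2 := by positivity
  have hin : ∀ t : ℝ, ⟪x, b - t • x⟫ = ⟪x, b⟫ - t * ‖x‖ ^ 2 := by
    intro t
    rw [inner_sub_right, inner_smul_right, real_inner_self_eq_norm_sq]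
  apply existsUnique_of_exists_of_unique
  · rcases le_or_gt |⟪x, b⟫| lam with h | h
    · refine ⟨0, (scalar_isMin_iff hlam.le).2 ⟨?_, ?_⟩⟩
      · simpa using h
      · simp
    · rcases lt_abs.1 h with h | h
      · refine ⟨(⟪x, b⟫ - lam) / ‖x‖ ^ 2, (scalar_isMin_iff hlam.le).2 ?_⟩
        have : 0 < (⟪x, b⟫ - lam) / ‖x‖ ^ 2 := div_pos (by linarith) hx2
        rw [hin, div_mul_cancel₀ _ hx2.ne', abs_of_pos this]
        refine ⟨by simp [abs_of_pos hlam], by ring⟩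
      · refine ⟨(⟪x, b⟫ + lam) / ‖x‖ ^ 2, (scalar_isMin_iff hlam.le).2 ?_⟩
        have : (⟪x, b⟫ + lam) / ‖x‖ ^ 2 < 0 := div_neg_of_neg_of_pos (by linarith) hx2
        rw [hin, div_mul_cancel₀ _ hx2.ne', abs_of_neg this]
        refine ⟨by simp [abs_of_pos hlam], by ring⟩
  · intro t s ht hs
    obtain ⟨h₁, h₂⟩ := (scalar_isMin_iff hlam.le).1 ht
    have h3 := scalar_lower_bound h₁ h₂ s
    have h4 := hs t
    have h5 : (s - t) ^ 2 * ‖x‖ ^ 2 ≤ 0 := by linarith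
    have h6 : (s - t) ^ 2 = 0 := le_antisymm (nonpos_of_mul_nonpos_left h5 hx2) (sq_nonneg _)
    have := pow_eq_zero_iff (two_ne_zero) |>.1 h6
    linarith

/-! ### Lasso solutions -/

theorem fit_eq_sum (X : Matrix (Fin n) (Fin p) ℝ) (w : Fin p → ℝ) :
    fit X w = ∑ j, w j • column X j := by
  ext r
  simp [fit, column, Matrix.mulVec, dotProduct, mul_comm]

theorem fit_sub (X : Matrix (Fin n) (Fin p) ℝ) (v w : Fin p → ℝ) :
    fit X (v - w) = fit X v - fit X w := by
  simp [fit, Matrix.mulVec_sub]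

theorem sigmaNorm_eq_norm_fit (X : Matrix (Fin n) (Fin p) ℝ) (z : Fin p → ℝ) :
    sigmaNorm X z = ‖fit X z‖ := by
  rw [sigmaNorm, EuclideanSpace.norm_eq, ← Matrix.mulVec_mulVec, Matrix.dotProduct_mulVec,
    Matrix.vecMul_transpose]
  simp [fit, dotProduct, sq]

theorem continuous_fit (X : Matrix (Fin n) (Fin p) ℝ) : Continuous (fit X) := by
  have : fit X = fun w => ∑ j, w j • column X j := funext (fit_eq_sum X)
  rw [this]
  fun_prop

theorem inner_fit (X : Matrix (Fin n) (Fin p) ℝ) (w : Fin p → ℝ)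
    (r : EuclideanSpace ℝ (Fin n)) : ⟪fit X w, r⟫ = ∑ j, w j * ⟪column X j, r⟫ := by
  simp [fit_eq_sum, sum_inner, inner_smul_left]

/-- Second-order expansion of the objective around `w`. -/
theorem lassoObjective_sub (X : Matrix (Fin n) (Fin p) ℝ) (y : EuclideanSpace ℝ (Fin n))
    (lam : ℝ) (v w : Fin p → ℝ) :
    lassoObjective X y lam v - lassoObjective X y lam w =
      (1 / 2) * ‖fit X (v - w)‖ ^ 2 + ∑ i, ((lam * |v i| - lam * |w i|) -
        (v i - w i) * ⟪column X i, y - fit X w⟫) := by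
  have e : y - fit X v = (y - fit X w) - fit X (v - w) := by rw [fit_sub]; abel
  have h : ∑ i, (v i - w i) * ⟪column X i, y - fit X w⟫ = ⟪y - fit X w, fit X (v - w)⟫ := by
    rw [real_inner_comm, inner_fit]
    rfl
  rw [lassoObjective, e, norm_sub_sq_real, lassoObjective, Finset.sum_sub_distrib,
    Finset.sum_sub_distrib, h, Finset.mul_sum, Finset.mul_sum]
  ring

theorem mul_sub_le_of_subgradient {lam g v w : ℝ} (h₁ : |g| ≤ lam) (h₂ : w * g = lam * |w|) :
    (v - w) * g ≤ lam * |v| - lam * |w| := by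
  have : v * g ≤ lam * |v| :=
    calc v * g ≤ |v * g| := le_abs_self _
      _ = |g| * |v| := by rw [abs_mul, mul_comm]
      _ ≤ lam * |v| := by gcongr
  linarith

/-- The Karush–Kuhn–Tucker conditions of the lasso. -/
theorem isLassoSolution_iff {X : Matrix (Fin n) (Fin p) ℝ} {y : EuclideanSpace ℝ (Fin n)}
    {lam : ℝ} (hlam : 0 ≤ lam) {w : Fin p → ℝ} :
    IsLassoSolution X y lam w ↔ ∀ i, |⟪column X i, y - fit X w⟫| ≤ lam ∧
      w i * ⟪column X i, y - fit X w⟫ = lam * |w i| := by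
  constructor
  · intro h i
    have hb : ∀ s : ℝ, y - fit X (Function.update w i s) =
        (y - fit X w + w i • column X i) - s • column X i := by
      intro s
      have : fit X (Function.update w i s) - fit X w = (s - w i) • column X i := by
        rw [← fit_sub, fit_eq_sum, Finset.sum_eq_single i]
        · simp
        · intro j _ hj
          simp [hj]
        · simp
      rw [sub_smul] at this
      rw [eq_add_of_sub_eq this]
      abel
    have hs : ∀ s : ℝ, ∑ j, |Function.update w i s j| =
        |s| + ∑ j ∈ Finset.univ.erase i, |w j| := by
      intro s
      rw [← Finset.add_sum_erase _ _ (Finset.mem_univ i)]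
      congr 1
      · simp
      · refine Finset.sum_congr rfl fun j hj => ?_
        rw [Function.update_of_ne (Finset.ne_of_mem_erase hj)]
    have := (scalar_isMin_iff (b := y - fit X w + w i • column X i) (x := column X i)
      (t := w i) hlam).1 (fun s => by
        have h1 := h (Function.update w i s)
        nth_rewrite 1 [← Function.update_eq_self i w] at h1
        simp only [lassoObjective, hb, hs] at h1
        linarith)
    simpa using this
  · intro h v
    have h1 := lassoObjective_sub X y lam v w
    have h2 : 0 ≤ ∑ i, ((lam * |v i| - lam * |w i|) -
        (v i - w i) * ⟪column X i, y - fit X w⟫) :=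
      Finset.sum_nonneg fun i _ => sub_nonneg.2 (mul_sub_le_of_subgradient (h i).1 (h i).2)
    have : 0 ≤ (1 / 2) * ‖fit X (v - w)‖ ^ 2 := by positivity
    linarith

theorem exists_isLassoSolution (X : Matrix (Fin n) (Fin p) ℝ) (y : EuclideanSpace ℝ (Fin n))
    {lam : ℝ} (hlam : 0 < lam) : ∃ w, IsLassoSolution X y lam w := by
  refine Continuous.exists_forall_le (f := lassoObjective X y lam) ?_ ?_
  · have := continuous_fit X
    unfold lassoObjective
    fun_prop
  · refine tendsto_atTop_mono (f := fun w : Fin p → ℝ => lam * ‖w‖) (fun w => ?_)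
      (tendsto_norm_cocompact_atTop.const_mul_atTop hlam)
    have h1 : ‖w‖ ≤ ∑ i, |w i| := by
      refine (pi_norm_le_iff_of_nonneg (Finset.sum_nonneg fun i _ => abs_nonneg _)).2 fun i => ?_
      exact Finset.single_le_sum (f := fun i => |w i|) (fun i _ => abs_nonneg _)
        (Finset.mem_univ i)
    have h2 : lam * ‖w‖ ≤ lam * ∑ i, |w i| := by gcongr
    have : 0 ≤ (1 / 2) * ‖y - fit X w‖ ^ 2 := by positivity
    unfold lassoObjective
    linarith

/-- General position makes any family of columns that are equally correlated in absolute value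
with a single vector linearly independent: taking inner products with that vector turns a linear
dependence between suitably signed columns into an affine one. -/
theorem linearIndepOn_column {X : Matrix (Fin n) (Fin p) ℝ} (hgen : GeneralPosition X)
    {lam : ℝ} (hlam : 0 < lam) {r : EuclideanSpace ℝ (Fin n)} (S : Finset (Fin p))
    (hS : ∀ i ∈ S, |⟪column X i, r⟫| = lam) :
    LinearIndepOn ℝ (column X) (S : Set (Fin p)) := by
  induction S using Finset.induction_on with
  | empty => simp
  | insert i S hi ih =>
    have ihS := ih fun j hj => hS j (Finset.mem_insert_of_mem hj)
    rw [Finset.coe_insert, linearIndepOn_insert (by simpa using hi)]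
    refine ⟨ihS, fun hmem => ?_⟩
    set σ : Fin p → ℝ := fun j => if ⟪column X j, r⟫ < 0 then -1 else 1 with hσ
    have hσ1 : ∀ j, σ j = 1 ∨ σ j = -1 := by
      intro j
      by_cases h : ⟪column X j, r⟫ < 0 <;> simp [hσ, h]
    have hσ2 : ∀ j, σ j * σ j = 1 := by
      intro j
      rcases hσ1 j with h | h <;> simp [h]
    have hσr : ∀ j ∈ insert i S, ⟪σ j • column X j, r⟫ = lam := by
      intro j hj
      rw [inner_smul_left, ← hS j hj]
      by_cases h : ⟪column X j, r⟫ < 0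
      · simp [hσ, h, abs_of_neg h]
      · simp [hσ, h, abs_of_nonneg (not_lt.1 h)]
    have hcard : S.card ≤ min n p := by
      refine le_min ?_ ?_
      · have := LinearIndependent.fintype_card_le_finrank ihS
        simpa using this
      · simpa using Finset.card_le_univ S
    obtain ⟨c, hc⟩ := (Submodule.mem_span_image_finset_iff_exists_fun' ℝ).1 hmem
    have hcomb : ∑ j ∈ S, (σ i * c j * σ j) • (σ j • column X j) = σ i • column X i := by
      rw [← hc, Finset.smul_sum]
      refine Finset.sum_congr rfl fun j _ => ?_
      rw [smul_smul, smul_smul, mul_assoc, hσ2, mul_one]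
    have hsum : ∑ j ∈ S, σ i * c j * σ j = 1 := by
      have h1 := hσr i (Finset.mem_insert_self _ _)
      rw [← hcomb, sum_inner] at h1
      have h2 : ∑ j ∈ S, ⟪(σ i * c j * σ j) • (σ j • column X j), r⟫ =
          (∑ j ∈ S, σ i * c j * σ j) * lam := by
        rw [Finset.sum_mul]
        refine Finset.sum_congr rfl fun j hj => ?_
        rw [inner_smul_left, hσr j (Finset.mem_insert_of_mem hj)]
        rfl
      rw [h2] at h1
      exact mul_right_cancel₀ hlam.ne' (by linarith)
    refine hgen σ hσ1 S hcard i hi ?_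
    rw [← hcomb, ← Finset.affineCombination_eq_linear_combination S
      (fun j => σ j • column X j) _ hsum]
    exact affineCombination_mem_affineSpan_image hsum (fun j hj hj' => absurd hj hj') _

theorem activeSet_subset_equicorrelationSet {X : Matrix (Fin n) (Fin p) ℝ}
    {y : EuclideanSpace ℝ (Fin n)} {lam : ℝ} (hlam : 0 < lam) {w : Fin p → ℝ}
    (hw : IsLassoSolution X y lam w) : activeSet w ⊆ equicorrelationSet X y lam w := by
  intro i hi
  have hi' : w i ≠ 0 := by simpa [activeSet] using hi
  have h := congrArg abs ((isLassoSolution_iff hlam.le).1 hw i).2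
  rw [abs_mul, abs_mul, abs_abs, abs_of_pos hlam, mul_comm] at h
  simpa [equicorrelationSet] using mul_right_cancel₀ (abs_ne_zero.2 hi') h

/-- Columns that are independent on a set carrying the support determine the coefficients. -/
theorem eq_zero_of_fit_eq_zero {X : Matrix (Fin n) (Fin p) ℝ} {S : Finset (Fin p)}
    (hS : LinearIndepOn ℝ (column X) (S : Set (Fin p))) {z : Fin p → ℝ}
    (hz : ∀ i ∉ S, z i = 0) (h : fit X z = 0) : z = 0 := by
  rw [fit_eq_sum, ← Finset.sum_subset (Finset.subset_univ S)
    (fun i _ hi => by rw [hz i hi, zero_smul])] at h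
  ext i
  by_cases hi : i ∈ S
  · exact linearIndepOn_finset_iff.1 hS z h i hi
  · exact hz i hi

theorem IsLassoSolution.unique {X : Matrix (Fin n) (Fin p) ℝ} (hgen : GeneralPosition X)
    {y : EuclideanSpace ℝ (Fin n)} {lam : ℝ} (hlam : 0 < lam) {v w : Fin p → ℝ}
    (hv : IsLassoSolution X y lam v) (hw : IsLassoSolution X y lam w) : v = w := by
  have hK := (isLassoSolution_iff hlam.le).1 hw
  have h1 := lassoObjective_sub X y lam v w
  have h2 : 0 ≤ ∑ i, ((lam * |v i| - lam * |w i|) -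
      (v i - w i) * ⟪column X i, y - fit X w⟫) :=
    Finset.sum_nonneg fun i _ => sub_nonneg.2 (mul_sub_le_of_subgradient (hK i).1 (hK i).2)
  have h3 := hv w
  have h4 : ‖fit X (v - w)‖ ^ 2 = 0 := le_antisymm (by linarith) (sq_nonneg _)
  have h5 : fit X (v - w) = 0 := by simpa using h4
  have h6 : fit X v = fit X w := by rwa [fit_sub, sub_eq_zero] at h5
  have hE : equicorrelationSet X y lam v = equicorrelationSet X y lam w := by
    rw [equicorrelationSet, h6, equicorrelationSet]
  have h7 : ∀ u, IsLassoSolution X y lam u →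
      equicorrelationSet X y lam u = equicorrelationSet X y lam w →
      ∀ i ∉ equicorrelationSet X y lam w, u i = 0 := by
    intro u hu hEu i hi
    by_contra hne
    exact hi (hEu ▸ activeSet_subset_equicorrelationSet hlam hu (by simpa [activeSet] using hne))
  refine sub_eq_zero.1 (eq_zero_of_fit_eq_zero (linearIndepOn_column hgen hlam
    (equicorrelationSet X y lam w) (r := y - fit X w) fun i hi => ?_) (fun i hi => ?_) h5)
  · simpa [equicorrelationSet] using hi
  · simp [h7 v hv hE i hi, h7 w hw rfl i hi]

theorem existsUnique_isLassoSolution {X : Matrix (Fin n) (Fin p) ℝ} (hgen : GeneralPosition X)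
    (y : EuclideanSpace ℝ (Fin n)) {lam : ℝ} (hlam : 0 < lam) :
    ∃! w, IsLassoSolution X y lam w :=
  existsUnique_of_exists_of_unique (exists_isLassoSolution X y hlam)
    fun _ _ hv hw => hv.unique hgen hlam hw

/-! ### Almost every response has its equicorrelation set equal to the active set -/

theorem volume_hyperplane {v : EuclideanSpace ℝ (Fin n)} (hv : v ≠ 0) (c : ℝ) :
    volume {y : EuclideanSpace ℝ (Fin n) | ⟪v, y⟫ = c} = 0 := by
  have h := Measure.addHaar_affineSubspace (volume : Measure (EuclideanSpace ℝ (Fin n)))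
    ((AffineSubspace.mk' c ⊥).comap (innerₛₗ ℝ v).toAffineMap) (fun htop => ?_)
  · convert h using 2
    ext y
    simp [AffineSubspace.mem_mk', sub_eq_zero]
  · have hall : ∀ y, ⟪v, y⟫ = c := fun y => by
      have : y ∈ (AffineSubspace.mk' c ⊥).comap (innerₛₗ ℝ v).toAffineMap :=
        htop ▸ AffineSubspace.mem_top ℝ _ y
      simpa [AffineSubspace.mem_mk', sub_eq_zero] using this
    have h0 := hall 0
    have h1 := hall v
    rw [inner_zero_right] at h0
    rw [← h0, inner_self_eq_zero] at h1
    exact hv h1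

/-- If `y = X w + r` with `w` supported on `S` and the correlations of `r` with the columns in
`S ∪ {i}` prescribed, then `y` lies in a fixed hyperplane orthogonal to `P_S^⊥ X_i`. -/
theorem ae_inner_column_ne (X : Matrix (Fin n) (Fin p) ℝ) (lam : ℝ) (S : Finset (Fin p))
    (i : Fin p) (σ : Fin p → ℝ) (hv : orthProj X S (column X i) ≠ 0) :
    ∀ᵐ y : EuclideanSpace ℝ (Fin n), ∀ w : Fin p → ℝ, (∀ j ∉ S, w j = 0) →
      (∀ j ∈ S, ⟪column X j, y - fit X w⟫ = σ j * lam) →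
      ⟪column X i, y - fit X w⟫ ≠ σ i * lam := by
  set U := Submodule.span ℝ (column X '' (S : Set (Fin p))) with hU
  obtain ⟨a, ha⟩ := (Submodule.mem_span_image_finset_iff_exists_fun' ℝ).1
    (U.starProjection_apply_mem (column X i))
  have hva : orthProj X S (column X i) = column X i - ∑ j ∈ S, a j • column X j := by
    rw [orthProj, ha, Submodule.starProjection_orthogonal_val]
  refine measure_mono_null (fun y hy => ?_)
    (volume_hyperplane hv (σ i * lam - ∑ j ∈ S, a j * (σ j * lam)))
  simp only [Set.mem_compl_iff, Set.mem_ofPred_eq, not_forall, not_not] at hy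
  obtain ⟨w, hw, hS, hi⟩ := hy
  have hfit : ⟪orthProj X S (column X i), fit X w⟫ = 0 := by
    refine Submodule.inner_left_of_mem_orthogonal (K := U) ?_ (Uᗮ.starProjection_apply_mem _)
    rw [fit_eq_sum]
    refine Submodule.sum_mem _ fun j _ => ?_
    by_cases hj : j ∈ S
    · exact Submodule.smul_mem _ _ (Submodule.subset_span ⟨j, hj, rfl⟩)
    · simp [hw j hj]
  have hy : ⟪orthProj X S (column X i), y⟫ =
      ⟪orthProj X S (column X i), y - fit X w⟫ := by
    rw [inner_sub_right, hfit, sub_zero]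
  rw [Set.mem_ofPred_eq, hy, hva, inner_sub_left, hi, sum_inner]
  congr 1
  refine Finset.sum_congr rfl fun j hj => ?_
  rw [inner_smul_left, hS j hj]
  rfl

theorem ae_equicorrelationSet_eq_activeSet {X : Matrix (Fin n) (Fin p) ℝ}
    (hgen : GeneralPosition X) {lam : ℝ} (hlam : 0 < lam) :
    ∀ᵐ y : EuclideanSpace ℝ (Fin n), ∀ w : Fin p → ℝ, IsLassoSolution X y lam w →
      equicorrelationSet X y lam w = activeSet w := by
  have hae : ∀ᵐ y : EuclideanSpace ℝ (Fin n), ∀ (S : Finset (Fin p)) (i : Fin p)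
      (σ : Fin p → SignType), orthProj X S (column X i) ≠ 0 → ∀ w : Fin p → ℝ,
      (∀ j ∉ S, w j = 0) → (∀ j ∈ S, ⟪column X j, y - fit X w⟫ = (σ j : ℝ) * lam) →
      ⟪column X i, y - fit X w⟫ ≠ (σ i : ℝ) * lam := by
    refine ae_all_iff.2 fun S => ae_all_iff.2 fun i => ae_all_iff.2 fun σ => ?_
    by_cases hv : orthProj X S (column X i) = 0
    · simp [hv]
    · filter_upwards [ae_inner_column_ne X lam S i (fun j => (σ j : ℝ)) hv] with y hy _
      exact hy
  filter_upwards [hae] with y hy w hw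
  refine Finset.Subset.antisymm (fun i hi => ?_) (activeSet_subset_equicorrelationSet hlam hw)
  by_contra hiA
  have hE : ∀ j ∈ equicorrelationSet X y lam w, |⟪column X j, y - fit X w⟫| = lam :=
    fun j hj => by simpa [equicorrelationSet] using hj
  have hsub := activeSet_subset_equicorrelationSet hlam hw
  have hsign : ∀ j ∈ equicorrelationSet X y lam w, ⟪column X j, y - fit X w⟫ =
      (SignType.sign ⟪column X j, y - fit X w⟫ : ℝ) * lam := by
    intro j hj
    conv_rhs => rw [← hE j hj]
    rw [sign_mul_abs]
  have hli := linearIndepOn_column hgen hlam (insert i (activeSet w)) (r := y - fit X w)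
    fun j hj => hE j (Finset.insert_subset hi hsub hj)
  rw [Finset.coe_insert, linearIndepOn_insert (by simpa using hiA)] at hli
  refine hy (activeSet w) i (fun j => SignType.sign ⟪column X j, y - fit X w⟫) ?_ w
    (fun j hj => by simpa [activeSet] using hj) (fun j hj => hsign j (hsub hj)) (hsign i hi)
  intro h0
  apply hli.2
  rw [orthProj, Submodule.starProjection_orthogonal_val, sub_eq_zero] at h0
  rw [h0]
  exact Submodule.starProjection_apply_mem _ _

/-! ### Products of projections onto hyperplanes -/

section Contraction

variable {E : Type*} [NormedAddCommGroup E] [InnerProductSpace ℝ E] [FiniteDimensional ℝ E]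

/-- A vector of `U + ℝ x` orthogonal to `x` keeps at least the fraction `‖P_U^⊥ x‖² / ‖x‖²` of its
squared norm when projected onto `U`. -/
theorem norm_sq_starProjection_ge (U : Submodule ℝ E) {x v : E}
    (hv : v ∈ U ⊔ Submodule.span ℝ {x}) (hxv : ⟪x, v⟫ = 0) :
    ‖Uᗮ.starProjection x‖ ^ 2 * ‖v‖ ^ 2 ≤ ‖x‖ ^ 2 * ‖U.starProjection v‖ ^ 2 := by
  obtain ⟨a, ha, b, hb, rfl⟩ := Submodule.mem_sup.1 hv
  obtain ⟨β, rfl⟩ := Submodule.mem_span_singleton.1 hb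
  set v := a + β • x with hvdef
  set q := Uᗮ.starProjection x
  have hq : Uᗮ.starProjection v = β • q := by
    rw [hvdef, map_add, map_smul, Submodule.starProjection_orthogonal_apply_eq_zero ha, zero_add]
  have hv2 := Submodule.norm_sq_eq_add_norm_sq_starProjection v U
  have hx2 := Submodule.norm_sq_eq_add_norm_sq_starProjection x U
  rw [hq, norm_smul, mul_pow, Real.norm_eq_abs, sq_abs] at hv2
  have hxq : ⟪x, q⟫ = ‖q‖ ^ 2 := by
    have : ⟪U.starProjection x, q⟫ = 0 :=
      Submodule.inner_right_of_mem_orthogonal (U.starProjection_apply_mem x)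
        (Uᗮ.starProjection_apply_mem x)
    conv_lhs => rw [← U.starProjection_add_starProjection_orthogonal x]
    rw [inner_add_left, this, zero_add, real_inner_self_eq_norm_sq]
  have hxv' : ⟪U.starProjection x, U.starProjection v⟫ = -(β * ‖q‖ ^ 2) := by
    have h1 : ⟪U.starProjection x, U.starProjection v⟫ = ⟪x, U.starProjection v⟫ := by
      rw [Submodule.inner_starProjection_left_eq_right,
        Submodule.starProjection_eq_self_iff.2 (U.starProjection_apply_mem v)]
    have h2 := U.starProjection_add_starProjection_orthogonal v
    rw [hq] at h2
    rw [← h2, inner_add_right, inner_smul_right, hxq] at hxv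
    linarith
  have hcs := abs_real_inner_le_norm (U.starProjection x) (U.starProjection v)
  rw [hxv', abs_neg] at hcs
  have hcs2 : (β * ‖q‖ ^ 2) ^ 2 ≤ ‖U.starProjection x‖ ^ 2 * ‖U.starProjection v‖ ^ 2 := by
    rw [← mul_pow, ← sq_abs (β * ‖q‖ ^ 2)]
    gcongr
  rw [hv2, hx2]
  linarith

/-- One step of the contraction estimate: `v` is the projection of `u` onto `x^⊥`. -/
theorem norm_sq_sub_le_of_projection_step (U : Submodule ℝ E) {x u v : E} (hx : x ≠ 0)
    (hxv : ⟪x, v⟫ = 0) {t : ℝ} (huv : u - v = t • x) {c : ℝ} (hc0 : 0 ≤ c) (hc1 : c ≤ 1) :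
    ‖v‖ ^ 2 - c * ‖U.starProjection v‖ ^ 2 ≤
      ‖u‖ ^ 2 - ‖Uᗮ.starProjection x‖ ^ 2 / ‖x‖ ^ 2 * c *
        ‖(U ⊔ Submodule.span ℝ {x}).starProjection u‖ ^ 2 := by
  set W := U ⊔ Submodule.span ℝ {x} with hW
  set s := ‖Uᗮ.starProjection x‖ ^ 2 / ‖x‖ ^ 2 with hs
  have hx2 : 0 < ‖x‖ ^ 2 := by positivity
  have hxW : x ∈ W := Submodule.mem_sup_right (Submodule.mem_span_singleton_self x)
  have hs0 : 0 ≤ s := by positivity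
  have hs1 : s ≤ 1 := by
    rw [hs, div_le_one hx2]
    gcongr
    exact Submodule.norm_starProjection_apply_le _ _
  have hPv : U.starProjection (W.starProjection v) = U.starProjection v := by
    rw [← ContinuousLinearMap.comp_apply,
      Submodule.starProjection_comp_starProjection_of_le le_sup_left]
  have hxPv : ⟪x, W.starProjection v⟫ = 0 := by
    rw [← Submodule.inner_starProjection_left_eq_right,
      Submodule.starProjection_eq_self_iff.2 hxW, hxv]
  have hge : s * ‖W.starProjection v‖ ^ 2 ≤ ‖U.starProjection v‖ ^ 2 := by
    have := norm_sq_starProjection_ge U (W.starProjection_apply_mem v) hxPv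
    rw [hPv] at this
    rw [hs, div_mul_eq_mul_div, div_le_iff₀ hx2]
    linarith
  have hu : u = v + t • x := by rw [← huv]; abel
  have hu2 : ‖u‖ ^ 2 = ‖v‖ ^ 2 + ‖t • x‖ ^ 2 := by
    rw [hu, norm_add_sq_real, inner_smul_right, real_inner_comm, hxv]
    ring
  have hPu2 : ‖W.starProjection u‖ ^ 2 = ‖W.starProjection v‖ ^ 2 + ‖t • x‖ ^ 2 := by
    rw [hu, map_add, Submodule.starProjection_eq_self_iff.2 (W.smul_mem t hxW),
      norm_add_sq_real, inner_smul_right, real_inner_comm, hxPv]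
    ring
  rw [hu2, hPu2]
  have h1 : c * (s * ‖W.starProjection v‖ ^ 2) ≤ c * ‖U.starProjection v‖ ^ 2 := by gcongr
  have h2 : s * c * ‖t • x‖ ^ 2 ≤ 1 * ‖t • x‖ ^ 2 := by
    gcongr
    exact mul_le_one₀ hs1 hc0 hc1
  linarith

end Contraction

/-- The squared sine of the angle between `X_i` and the span of the columns in `S`. -/
noncomputable def sinSq (X : Matrix (Fin n) (Fin p) ℝ) (S : Finset (Fin p)) (i : Fin p) : ℝ :=
  ‖orthProj X S (column X i)‖ ^ 2 / ‖column X i‖ ^ 2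

theorem sinSq_nonneg (X : Matrix (Fin n) (Fin p) ℝ) (S : Finset (Fin p)) (i : Fin p) :
    0 ≤ sinSq X S i := by
  unfold sinSq
  positivity

theorem sinSq_le_one (X : Matrix (Fin n) (Fin p) ℝ) (S : Finset (Fin p)) (i : Fin p) :
    sinSq X S i ≤ 1 := by
  refine div_le_one_of_le₀ ?_ (by positivity)
  gcongr
  exact Submodule.norm_starProjection_apply_le _ _

/-- The Smith–Solmon–Wagner estimate for the successive projections onto the hyperplanes
`X_i^⊥`, `i ∈ A`, in increasing order of `i`. The sequence `e` records the partial results, with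
idle steps at indices outside `A`. The induction runs from the last projection backwards. -/
theorem norm_sq_le_of_successive_projections (X : Matrix (Fin n) (Fin p) ℝ)
    (hcol : ∀ i, column X i ≠ 0) (A : Finset (Fin p)) (e : ℕ → EuclideanSpace ℝ (Fin n))
    (horth : ∀ i ∈ A, ⟪column X i, e (i + 1)⟫ = 0)
    (hstep : ∀ i ∈ A, ∃ t : ℝ, e i - e (i + 1) = t • column X i)
    (hidle : ∀ i ∉ A, e (i + 1) = e i) {m : ℕ} (hm : m ≤ p) :
    ‖e p‖ ^ 2 ≤ ‖e m‖ ^ 2 -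
      (∏ i ∈ A.filter (fun i => m ≤ i.val), sinSq X (A.filter (fun l => i < l)) i) *
        ‖(Submodule.span ℝ (column X '' (A.filter (fun i => m ≤ i.val) :
          Set (Fin p)))).starProjection (e m)‖ ^ 2 := by
  induction hm using Nat.decreasingInduction with
  | self =>
    have : A.filter (fun i : Fin p => p ≤ i.val) = ∅ :=
      Finset.filter_false_of_mem fun i _ => not_le.2 i.isLt
    simp [this]
  | of_succ m hm ih =>
    refine ih.trans ?_
    have hlt : A.filter (fun i : Fin p => m + 1 ≤ i.val) =
        A.filter (fun l => (⟨m, hm⟩ : Fin p) < l) := by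
      ext l
      simp [Fin.lt_def]
    by_cases hA : (⟨m, hm⟩ : Fin p) ∈ A
    · have hins : A.filter (fun i : Fin p => m ≤ i.val) =
          insert ⟨m, hm⟩ (A.filter (fun i : Fin p => m + 1 ≤ i.val)) := by
        ext l
        simp only [Finset.mem_filter, Finset.mem_insert, Fin.ext_iff]
        constructor
        · rintro ⟨h1, h2⟩
          rcases h2.eq_or_lt with h | h
          · exact Or.inl h.symm
          · exact Or.inr ⟨h1, h⟩
        · rintro (h | ⟨h1, h2⟩)
          · have : l = ⟨m, hm⟩ := Fin.ext h
            exact ⟨this ▸ hA, h.ge⟩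
          · exact ⟨h1, by omega⟩
      have hnot : (⟨m, hm⟩ : Fin p) ∉ A.filter (fun i : Fin p => m + 1 ≤ i.val) := by simp
      obtain ⟨t, ht⟩ := hstep _ hA
      have := norm_sq_sub_le_of_projection_step
        (Submodule.span ℝ (column X '' (A.filter (fun i => m + 1 ≤ i.val) : Set (Fin p))))
        (hcol ⟨m, hm⟩) (horth _ hA) ht
        (Finset.prod_nonneg fun i (_ : i ∈ A.filter (fun i : Fin p => m + 1 ≤ i.val)) =>
          sinSq_nonneg X (A.filter (fun l => i < l)) i)
        (Finset.prod_le_one (fun i _ => sinSq_nonneg X _ i) fun i _ => sinSq_le_one X _ i)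
      rw [hins, Finset.prod_insert hnot, Finset.coe_insert, Set.image_insert_eq,
        Submodule.span_insert, sup_comm, sinSq, orthProj, ← hlt]
      exact this
    · have hsame : A.filter (fun i : Fin p => m ≤ i.val) =
          A.filter (fun i : Fin p => m + 1 ≤ i.val) := by
        refine Finset.filter_congr fun l hl => ?_
        have : l.val ≠ m := fun h => hA (by rwa [← (Fin.ext h : l = ⟨m, hm⟩)])
        omega
      have he : e (m + 1) = e m := hidle _ hA
      rw [hsame, he]

theorem norm_le_rateBound_mul_of_successive_projections (X : Matrix (Fin n) (Fin p) ℝ)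
    (hcol : ∀ i, column X i ≠ 0) (A : Finset (Fin p)) (e : ℕ → EuclideanSpace ℝ (Fin n))
    (horth : ∀ i ∈ A, ⟪column X i, e (i + 1)⟫ = 0)
    (hstep : ∀ i ∈ A, ∃ t : ℝ, e i - e (i + 1) = t • column X i)
    (hidle : ∀ i ∉ A, e (i + 1) = e i)
    (hmem : e 0 ∈ Submodule.span ℝ (column X '' (A : Set (Fin p)))) :
    ‖e p‖ ≤ rateBound X A * ‖e 0‖ := by
  have h := norm_sq_le_of_successive_projections X hcol A e horth hstep hidle (Nat.zero_le p)
  simp only [Nat.zero_le, Finset.filter_true] at h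
  -- the factor of the largest index is `1`, as no index of `A` follows it
  have hprod : ∏ i ∈ A, sinSq X (A.filter (fun l => i < l)) i =
      ∏ i ∈ A.filter (fun i => ∃ l ∈ A, i < l), sinSq X (A.filter (fun l => i < l)) i := by
    refine (Finset.prod_filter_of_ne fun i _ hne => ?_).symm
    by_contra! hmax
    refine hne ?_
    have : A.filter (fun l => i < l) = ∅ :=
      Finset.filter_false_of_mem fun l hl => not_lt.2 (hmax l hl)
    have h2 : ‖column X i‖ ^ 2 ≠ 0 := by simpa using hcol i
    rw [this, sinSq, orthProj, Submodule.starProjection_eq_self_iff.2 (by simp), div_self h2]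
  rw [hprod, Submodule.starProjection_eq_self_iff.2 hmem] at h
  rw [rateBound, ← Real.sqrt_sq (norm_nonneg (e 0)), ← Real.sqrt_mul']
  · exact Real.le_sqrt_of_sq_le (by simp only [sinSq] at h; linarith)
  · positivity

/-! ### Well-posedness of coordinate descent -/

/-- The coefficient vector in the middle of a cycle: the first `m` coordinates already have their
new values `v`, the others still have their old values `u`. -/
def hybrid (v u : Fin p → ℝ) (m : ℕ) : Fin p → ℝ := fun j => if j.val < m then v j else u j

theorem hybrid_zero (v u : Fin p → ℝ) : hybrid v u 0 = u := by
  ext j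
  simp [hybrid]

theorem hybrid_last (v u : Fin p → ℝ) : hybrid v u p = v := by
  ext j
  simp [hybrid]

theorem hybrid_of_ne (v u : Fin p → ℝ) {i j : Fin p} (h : j ≠ i) :
    hybrid v u (i + 1) j = hybrid v u i j := by
  have : j.val ≠ i.val := fun h' => h (Fin.ext h')
  have : j.val < i.val + 1 ↔ j.val < i.val := by omega
  simp [hybrid, this]

theorem hybrid_succ_self (v u : Fin p → ℝ) (i : Fin p) : hybrid v u (i + 1) i = v i := by
  simp [hybrid]

theorem hybrid_self (v u : Fin p → ℝ) (i : Fin p) : hybrid v u i i = u i := by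
  simp [hybrid]

theorem fit_hybrid_sub (X : Matrix (Fin n) (Fin p) ℝ) (v u : Fin p → ℝ) (i : Fin p) :
    fit X (hybrid v u i) - fit X (hybrid v u (i + 1)) = (u i - v i) • column X i := by
  rw [← fit_sub, fit_eq_sum, Finset.sum_eq_single i]
  · simp [hybrid_self, hybrid_succ_self]
  · intro j _ hj
    simp [hybrid_of_ne v u hj]
  · simp

theorem residual_eq (X : Matrix (Fin n) (Fin p) ℝ) (y : EuclideanSpace ℝ (Fin n))
    (v u : Fin p → ℝ) (i : Fin p) :
    y - ∑ j ∈ Finset.Iio i, v j • column X j - ∑ j ∈ Finset.Ioi i, u j • column X j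
      - v i • column X i = y - fit X (hybrid v u (i + 1)) := by
  have hsplit : (Finset.univ : Finset (Fin p)) = Finset.Iic i ∪ Finset.Ioi i := by
    ext j
    simp [le_or_gt]
  have hdisj : Disjoint (Finset.Iic i) (Finset.Ioi i) :=
    Finset.disjoint_left.2 fun j h1 h2 => by
      simp only [Finset.mem_Iic, Finset.mem_Ioi] at h1 h2
      exact absurd h2 (not_lt.2 h1)
  have h1 : ∑ j ∈ Finset.Iic i, hybrid v u (i + 1) j • column X j =
      v i • column X i + ∑ j ∈ Finset.Iio i, v j • column X j := by
    rw [← Finset.Iio_insert, Finset.sum_insert (by simp), hybrid_succ_self]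
    congr 1
    refine Finset.sum_congr rfl fun j hj => ?_
    have : j.val < i.val + 1 := Nat.lt_succ_of_lt (Fin.lt_def.1 (Finset.mem_Iio.1 hj))
    simp [hybrid, this]
  have h2 : ∑ j ∈ Finset.Ioi i, hybrid v u (i + 1) j • column X j =
      ∑ j ∈ Finset.Ioi i, u j • column X j := by
    refine Finset.sum_congr rfl fun j hj => ?_
    have : ¬ j.val < i.val + 1 := not_lt.2 (Nat.succ_le_of_lt (Fin.lt_def.1 (Finset.mem_Ioi.1 hj)))
    simp [hybrid, this]
  rw [fit_eq_sum, hsplit, Finset.sum_union hdisj, h1, h2]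
  abel

/-- Optimality of a coordinate update, in terms of the residual right after it. -/
theorem coordinateObjective_isMin_iff {X : Matrix (Fin n) (Fin p) ℝ}
    {y : EuclideanSpace ℝ (Fin n)} {lam : ℝ} (hlam : 0 ≤ lam) {v u : Fin p → ℝ} {i : Fin p} :
    (∀ t, coordinateObjective X y lam v u i (v i) ≤ coordinateObjective X y lam v u i t) ↔
      |⟪column X i, y - fit X (hybrid v u (i + 1))⟫| ≤ lam ∧
        v i * ⟪column X i, y - fit X (hybrid v u (i + 1))⟫ = lam * |v i| := by
  rw [← residual_eq]
  exact scalar_isMin_iff hlam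

theorem coordinateObjective_congr {X : Matrix (Fin n) (Fin p) ℝ} {y : EuclideanSpace ℝ (Fin n)}
    {lam : ℝ} {v v' u : Fin p → ℝ} {i : Fin p} (h : ∀ j < i, v j = v' j) (t : ℝ) :
    coordinateObjective X y lam v u i t = coordinateObjective X y lam v' u i t := by
  have : ∑ j ∈ Finset.Iio i, v j • column X j = ∑ j ∈ Finset.Iio i, v' j • column X j :=
    Finset.sum_congr rfl fun j hj => by rw [h j (Finset.mem_Iio.1 hj)]
  rw [coordinateObjective, this, coordinateObjective]

/-- A full cycle of coordinate descent started at `u` is well defined. -/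
theorem existsUnique_cycle {X : Matrix (Fin n) (Fin p) ℝ} (hcol : ∀ i, column X i ≠ 0)
    (y : EuclideanSpace ℝ (Fin n)) {lam : ℝ} (hlam : 0 < lam) (u : Fin p → ℝ) :
    ∃! v : Fin p → ℝ, ∀ i t,
      coordinateObjective X y lam v u i (v i) ≤ coordinateObjective X y lam v u i t := by
  apply existsUnique_of_exists_of_unique
  · have hex : ∀ m ≤ p, ∃ v : Fin p → ℝ, ∀ i : Fin p, i.val < m → ∀ t,
        coordinateObjective X y lam v u i (v i) ≤ coordinateObjective X y lam v u i t := by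
      intro m
      induction m with
      | zero => exact fun _ => ⟨0, fun i hi => absurd hi (Nat.not_lt_zero _)⟩
      | succ m ih =>
        intro hm
        obtain ⟨v, hv⟩ := ih (Nat.le_of_succ_le hm)
        obtain ⟨s, hs, -⟩ := scalar_existsUnique
          (y - ∑ j ∈ Finset.Iio (⟨m, hm⟩ : Fin p), v j • column X j
            - ∑ j ∈ Finset.Ioi (⟨m, hm⟩ : Fin p), u j • column X j) (hcol ⟨m, hm⟩) hlam
        refine ⟨Function.update v ⟨m, hm⟩ s, fun i hi t => ?_⟩
        have hne : ∀ j < i, Function.update v ⟨m, hm⟩ s j = v j := by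
          intro j hj
          refine Function.update_of_ne (fun h => ?_) _ _
          have h1 : j.val = m := congrArg Fin.val h
          have h2 : j.val < i.val := hj
          omega
        rw [coordinateObjective_congr hne, coordinateObjective_congr hne]
        by_cases him : i = ⟨m, hm⟩
        · subst him
          rw [Function.update_self]
          exact hs t
        · rw [Function.update_of_ne him]
          have : i.val ≠ m := fun h => him (Fin.ext h)
          exact hv i (by omega) t
    obtain ⟨v, hv⟩ := hex p le_rfl
    exact ⟨v, fun i => hv i i.isLt⟩
  · intro v v' hv hv'
    ext i
    induction i using WellFoundedLT.induction with
    | ind i ih =>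
      refine (scalar_existsUnique (y - ∑ j ∈ Finset.Iio i, v j • column X j
        - ∑ j ∈ Finset.Ioi i, u j • column X j) (hcol i) hlam).unique (hv i) fun t => ?_
      have := hv' i t
      rwa [← coordinateObjective_congr ih, ← coordinateObjective_congr ih] at this

theorem existsUnique_isCoordinateDescent {X : Matrix (Fin n) (Fin p) ℝ}
    (hcol : ∀ i, column X i ≠ 0) (y : EuclideanSpace ℝ (Fin n)) {lam : ℝ} (hlam : 0 < lam)
    (w₀ : Fin p → ℝ) : ∃! w : ℕ → Fin p → ℝ, w 0 = w₀ ∧ IsCoordinateDescent X y lam w := by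
  choose Φ hΦ hΦu using existsUnique_cycle hcol y hlam
  refine ⟨fun k => Φ^[k] w₀, ⟨rfl, fun k i t => ?_⟩, fun w hw => funext fun k => ?_⟩
  · simp only [Function.iterate_succ_apply']
    exact hΦ _ i t
  · induction k with
    | zero => exact hw.1
    | succ k ih =>
      rw [Function.iterate_succ_apply', ← ih]
      exact hΦu _ _ (hw.2 k)

/-! ### Global convergence of the fits -/

theorem lassoObjective_nonneg (X : Matrix (Fin n) (Fin p) ℝ) (y : EuclideanSpace ℝ (Fin n))
    {lam : ℝ} (hlam : 0 ≤ lam) (w : Fin p → ℝ) : 0 ≤ lassoObjective X y lam w := by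
  have : 0 ≤ ∑ i, |w i| := Finset.sum_nonneg fun i _ => abs_nonneg _
  unfold lassoObjective
  positivity

/-- A coordinate update decreases the objective by at least half the squared length of the change
of the fit. -/
theorem lassoObjective_hybrid_succ_le {X : Matrix (Fin n) (Fin p) ℝ}
    {y : EuclideanSpace ℝ (Fin n)} {lam : ℝ} {v u : Fin p → ℝ} {i : Fin p}
    (h₁ : |⟪column X i, y - fit X (hybrid v u (i + 1))⟫| ≤ lam)
    (h₂ : v i * ⟪column X i, y - fit X (hybrid v u (i + 1))⟫ = lam * |v i|) :
    lassoObjective X y lam (hybrid v u (i + 1)) + (1 / 2) * ‖(u i - v i) • column X i‖ ^ 2 ≤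
      lassoObjective X y lam (hybrid v u i) := by
  have h := lassoObjective_sub X y lam (hybrid v u i) (hybrid v u (i + 1))
  rw [fit_sub, fit_hybrid_sub, Finset.sum_eq_single i, hybrid_self, hybrid_succ_self] at h
  · have := mul_sub_le_of_subgradient (v := u i) h₁ h₂
    linarith
  · intro j _ hj
    simp [hybrid_of_ne v u hj]
  · simp

section Convergence

variable {X : Matrix (Fin n) (Fin p) ℝ} {y : EuclideanSpace ℝ (Fin n)} {lam : ℝ}
  {w : ℕ → Fin p → ℝ}

theorem IsCoordinateDescent.kkt (hlam : 0 ≤ lam) (hw : IsCoordinateDescent X y lam w) (k : ℕ)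
    (i : Fin p) :
    |⟪column X i, y - fit X (hybrid (w (k + 1)) (w k) (i + 1))⟫| ≤ lam ∧
      w (k + 1) i * ⟪column X i, y - fit X (hybrid (w (k + 1)) (w k) (i + 1))⟫ =
        lam * |w (k + 1) i| :=
  (coordinateObjective_isMin_iff hlam).1 (hw k i)

theorem IsCoordinateDescent.lassoObjective_add_le (hlam : 0 ≤ lam)
    (hw : IsCoordinateDescent X y lam w) (k : ℕ) {m : ℕ} (hm : m ≤ p) :
    lassoObjective X y lam (hybrid (w (k + 1)) (w k) m) +
        ∑ i : Fin p with i.val < m, (1 / 2) * ‖(w k i - w (k + 1) i) • column X i‖ ^ 2 ≤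
      lassoObjective X y lam (w k) := by
  induction m with
  | zero => simp [hybrid_zero]
  | succ m ih =>
    have h1 := ih (Nat.le_of_succ_le hm)
    obtain ⟨h₁, h₂⟩ := hw.kkt hlam k ⟨m, hm⟩
    have h2 := lassoObjective_hybrid_succ_le h₁ h₂
    have h3 : Finset.univ.filter (fun i : Fin p => i.val < m + 1) =
        insert ⟨m, hm⟩ (Finset.univ.filter (fun i : Fin p => i.val < m)) := by
      ext i
      simp only [Finset.mem_filter, Finset.mem_univ, true_and, Finset.mem_insert, Fin.ext_iff]
      omega
    rw [h3, Finset.sum_insert (by simp)]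
    simp only at h2
    linarith

theorem IsCoordinateDescent.lassoObjective_succ_add_le (hlam : 0 ≤ lam)
    (hw : IsCoordinateDescent X y lam w) (k : ℕ) (i : Fin p) :
    lassoObjective X y lam (w (k + 1)) + (1 / 2) * ‖(w k i - w (k + 1) i) • column X i‖ ^ 2 ≤
      lassoObjective X y lam (w k) := by
  have h := hw.lassoObjective_add_le hlam k le_rfl
  simp only [hybrid_last, Fin.is_lt, Finset.filter_true] at h
  have := Finset.single_le_sum
    (f := fun i => (1 / 2 : ℝ) * ‖(w k i - w (k + 1) i) • column X i‖ ^ 2)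
    (fun i _ => by positivity) (Finset.mem_univ i)
  linarith

theorem IsCoordinateDescent.antitone_lassoObjective (hlam : 0 ≤ lam)
    (hw : IsCoordinateDescent X y lam w) : Antitone fun k => lassoObjective X y lam (w k) := by
  refine antitone_nat_of_succ_le fun k => ?_
  have h := hw.lassoObjective_add_le hlam k le_rfl
  simp only [hybrid_last, Fin.is_lt, Finset.filter_true] at h
  have : 0 ≤ ∑ i, (1 / 2) * ‖(w k i - w (k + 1) i) • column X i‖ ^ 2 :=
    Finset.sum_nonneg fun i _ => by positivity
  linarith

/-- The steps of coordinate descent tend to zero, as the objective decreases to a limit. -/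
theorem IsCoordinateDescent.tendsto_step (hlam : 0 ≤ lam) (hw : IsCoordinateDescent X y lam w)
    (i : Fin p) :
    Tendsto (fun k => (w k i - w (k + 1) i) • column X i) atTop (nhds 0) := by
  have hlim := tendsto_atTop_ciInf (hw.antitone_lassoObjective hlam)
    ⟨0, by rintro _ ⟨k, rfl⟩; exact lassoObjective_nonneg X y hlam _⟩
  have hdiff := hlim.sub ((tendsto_add_atTop_iff_nat 1).2 hlim)
  rw [sub_self] at hdiff
  have hsq : Tendsto (fun k => ‖(w k i - w (k + 1) i) • column X i‖ ^ 2) atTop (nhds 0) := by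
    refine squeeze_zero (fun k => sq_nonneg _) (fun k => ?_) (by simpa using hdiff.const_mul 2)
    have := hw.lassoObjective_succ_add_le hlam k i
    linarith
  have := hsq.sqrt
  simp only [Real.sqrt_sq (norm_nonneg _), Real.sqrt_zero] at this
  exact tendsto_zero_iff_norm_tendsto_zero.2 this

theorem IsCoordinateDescent.tendsto_fit_hybrid_sub (hlam : 0 ≤ lam)
    (hw : IsCoordinateDescent X y lam w) (m : ℕ) :
    Tendsto (fun k => fit X (w (k + 1)) - fit X (hybrid (w (k + 1)) (w k) m)) atTop
      (nhds 0) := by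
  have heq : ∀ k, fit X (w (k + 1)) - fit X (hybrid (w (k + 1)) (w k) m) =
      ∑ j : Fin p, if j.val < m then 0 else -((w k j - w (k + 1) j) • column X j) := by
    intro k
    rw [← fit_sub, fit_eq_sum]
    refine Finset.sum_congr rfl fun j _ => ?_
    by_cases hj : j.val < m
    · simp [hybrid, hj]
    · simp [hybrid, hj, ← neg_smul]
  simp only [heq]
  rw [← Finset.sum_const_zero (s := (Finset.univ : Finset (Fin p)))]
  refine tendsto_finsetSum _ fun j _ => ?_
  by_cases hj : j.val < m
  · simp [hj]
  · simpa [hj] using (hw.tendsto_step hlam j).neg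

/-- The fits converge. Every cycle ends at a point satisfying the optimality conditions up to an
error that tends to zero, and convexity bounds the distance of its fit from the optimal one. -/
theorem IsCoordinateDescent.tendsto_fit (hlam : 0 < lam) (hw : IsCoordinateDescent X y lam w)
    {what : Fin p → ℝ} (hwhat : IsLassoSolution X y lam what) :
    Tendsto (fun k => fit X (w k)) atTop (nhds (fit X what)) := by
  set B := lassoObjective X y lam (w 0) / lam with hB
  have hbound : ∀ k i, |w k i| ≤ B := by
    intro k i
    have h1 := hw.antitone_lassoObjective hlam.le (Nat.zero_le k)
    have h2 : |w k i| ≤ ∑ i, |w k i| :=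
      Finset.single_le_sum (f := fun i => |w k i|) (fun i _ => abs_nonneg _) (Finset.mem_univ i)
    have h3 : lam * |w k i| ≤ lam * ∑ i, |w k i| := by gcongr
    have h4 : 0 ≤ (1 / 2) * ‖y - fit X (w k)‖ ^ 2 := by positivity
    rw [hB, le_div_iff₀ hlam]
    simp only at h1
    rw [lassoObjective] at h1
    linarith
  have hgap : ∀ k, (1 / 2) * ‖fit X (what - w (k + 1))‖ ^ 2 ≤ ∑ i, (|what i| + B) *
      |⟪column X i, fit X (w (k + 1)) - fit X (hybrid (w (k + 1)) (w k) (i + 1))⟫| := by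
    intro k
    have h1 := lassoObjective_sub X y lam what (w (k + 1))
    have h2 := hwhat (w (k + 1))
    have h3 : (1 / 2) * ‖fit X (what - w (k + 1))‖ ^ 2 ≤
        ∑ i, -((lam * |what i| - lam * |w (k + 1) i|) -
          (what i - w (k + 1) i) * ⟪column X i, y - fit X (w (k + 1))⟫) := by
      rw [Finset.sum_neg_distrib]
      linarith
    refine h3.trans (Finset.sum_le_sum fun i _ => ?_)
    obtain ⟨h₁, h₂⟩ := hw.kkt hlam.le k i
    have h4 := mul_sub_le_of_subgradient (v := what i) h₁ h₂
    have h5 : ⟪column X i, y - fit X (w (k + 1))⟫ =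
        ⟪column X i, y - fit X (hybrid (w (k + 1)) (w k) (i + 1))⟫ -
          ⟪column X i, fit X (w (k + 1)) - fit X (hybrid (w (k + 1)) (w k) (i + 1))⟫ := by
      rw [← inner_sub_right]
      congr 1
      abel
    set d := ⟪column X i, fit X (w (k + 1)) - fit X (hybrid (w (k + 1)) (w k) (i + 1))⟫
    have h6 : -((what i - w (k + 1) i) * d) ≤ (|what i| + B) * |d| :=
      calc -((what i - w (k + 1) i) * d) ≤ |(what i - w (k + 1) i) * d| := neg_le_abs _
        _ = |what i - w (k + 1) i| * |d| := abs_mul _ _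
        _ ≤ (|what i| + B) * |d| := by
          gcongr
          exact (abs_sub _ _).trans (by gcongr; exact hbound _ _)
    rw [h5]
    linarith
  have hsum : Tendsto (fun k => ∑ i, (|what i| + B) *
      |⟪column X i, fit X (w (k + 1)) - fit X (hybrid (w (k + 1)) (w k) (i + 1))⟫|)
      atTop (nhds 0) := by
    have h0 : ∑ _i : Fin p, (0 : ℝ) = 0 := Finset.sum_const_zero
    rw [← h0]
    refine tendsto_finsetSum _ fun i _ => ?_
    have h := (hw.tendsto_fit_hybrid_sub hlam.le (i + 1)).inner (𝕜 := ℝ)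
      (tendsto_const_nhds (x := column X i))
    simp only [real_inner_comm (column X i)] at h
    simpa using h.abs.const_mul (|what i| + B)
  have hsq : Tendsto (fun k => ‖fit X (what - w (k + 1))‖ ^ 2) atTop (nhds 0) := by
    refine squeeze_zero (fun k => sq_nonneg _) (fun k => ?_) (by simpa using hsum.const_mul 2)
    have := hgap k
    linarith
  have h := hsq.sqrt
  simp only [Real.sqrt_sq (norm_nonneg _), Real.sqrt_zero, fit_sub] at h
  rw [← tendsto_add_atTop_iff_nat 1, tendsto_iff_norm_sub_tendsto_zero]
  simpa only [norm_sub_rev] using h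

/-! ### Identification of the active set and the linear regime -/

theorem IsCoordinateDescent.tendsto_inner_residual (hlam : 0 < lam)
    (hw : IsCoordinateDescent X y lam w) {what : Fin p → ℝ}
    (hwhat : IsLassoSolution X y lam what) (i : Fin p) :
    Tendsto (fun k => ⟪column X i, y - fit X (hybrid (w (k + 1)) (w k) (i + 1))⟫) atTop
      (nhds ⟪column X i, y - fit X what⟫) := by
  have h1 := (tendsto_add_atTop_iff_nat 1).2 (hw.tendsto_fit hlam hwhat)
  have h2 := h1.sub (hw.tendsto_fit_hybrid_sub hlam.le (i + 1))
  simp only [sub_sub_cancel, sub_zero] at h2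
  exact tendsto_const_nhds.inner (tendsto_const_nhds.sub h2)

/-- A coordinate outside the equicorrelation set is eventually thresholded to zero. -/
theorem IsCoordinateDescent.eventually_eq_zero (hlam : 0 < lam)
    (hw : IsCoordinateDescent X y lam w) {what : Fin p → ℝ}
    (hwhat : IsLassoSolution X y lam what) :
    ∀ᶠ k in atTop, ∀ i ∉ equicorrelationSet X y lam what, w k i = 0 := by
  refine eventually_all.2 fun i => ?_
  by_cases hi : i ∈ equicorrelationSet X y lam what
  · simp [hi]
  have hlt : |⟪column X i, y - fit X what⟫| < lam :=
    lt_of_le_of_ne ((isLassoSolution_iff hlam.le).1 hwhat i).1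
      (by simpa [equicorrelationSet] using hi)
  rw [← map_add_atTop_eq_nat 1, eventually_map]
  filter_upwards [(hw.tendsto_inner_residual hlam hwhat i).abs.eventually_lt_const hlt] with k hk _
  have h := congrArg abs (hw.kkt hlam.le k i).2
  rw [abs_mul, abs_mul, abs_abs, abs_of_pos hlam, mul_comm] at h
  by_contra hne
  exact hk.ne (mul_right_cancel₀ (abs_ne_zero.2 hne) h)

/-- Linear independence of the columns in `S` bounds the coefficients supported on `S` by the norm
of their fit. -/
theorem exists_abs_le_mul_norm_fit {S : Finset (Fin p)}
    (hS : LinearIndepOn ℝ (column X) (S : Set (Fin p))) :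
    ∃ K : ℝ, ∀ z : Fin p → ℝ, (∀ i ∉ S, z i = 0) → ∀ i ∈ S, |z i| ≤ K * ‖fit X z‖ := by
  obtain ⟨K, -, hK⟩ := LinearMap.exists_antilipschitzWith
    (Fintype.linearCombination ℝ (fun i : S => column X i))
    (LinearMap.ker_eq_bot.2 (linearIndependent_iff_injective_fintypeLinearCombination.1 hS))
  refine ⟨K, fun z hz i hi => ?_⟩
  have h1 : Fintype.linearCombination ℝ (fun i : S => column X i) (fun i : S => z i) =
      fit X z := by
    rw [Fintype.linearCombination_apply, fit_eq_sum,
      ← Finset.sum_subset (Finset.subset_univ S) (fun i _ hi => by rw [hz i hi, zero_smul]),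
      ← Finset.sum_coe_sort S]
  have h2 := hK.le_mul_dist (fun i : S => z i) 0
  rw [map_zero, dist_zero_right, dist_zero_right, h1] at h2
  exact (norm_le_pi_norm (fun i : S => z i) ⟨i, hi⟩).trans h2

/-- The iterates eventually have the signs of the solution on its support. -/
theorem IsCoordinateDescent.eventually_mul_pos (hlam : 0 < lam)
    (hw : IsCoordinateDescent X y lam w) {what : Fin p → ℝ}
    (hwhat : IsLassoSolution X y lam what) (hgen : GeneralPosition X)
    (heq : equicorrelationSet X y lam what = activeSet what) :
    ∀ᶠ k in atTop, ∀ i ∈ activeSet what, 0 < what i * w k i := by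
  refine eventually_all.2 fun i => ?_
  by_cases hi : i ∈ activeSet what
  swap
  · simp [hi]
  have hne : what i ≠ 0 := by simpa [activeSet] using hi
  obtain ⟨K, hK⟩ := exists_abs_le_mul_norm_fit (linearIndepOn_column hgen hlam
    (activeSet what) (r := y - fit X what) fun j hj => by
      rw [← heq] at hj
      simpa [equicorrelationSet] using hj)
  have hlim : Tendsto (fun k => w k i) atTop (nhds (what i)) := by
    rw [tendsto_iff_norm_sub_tendsto_zero]
    have h := (tendsto_iff_norm_sub_tendsto_zero.1 (hw.tendsto_fit hlam hwhat)).const_mul K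
    rw [mul_zero] at h
    refine squeeze_zero' (Eventually.of_forall fun k => norm_nonneg _) ?_ h
    filter_upwards [hw.eventually_eq_zero hlam hwhat] with k hk
    rw [heq] at hk
    rw [← fit_sub]
    refine hK (w k - what) (fun j hj => ?_) i hi
    have : what j = 0 := by simpa [activeSet] using hj
    rw [Pi.sub_apply, hk j hj, this, sub_zero]
  have hpos : 0 < what i * what i := mul_self_pos.2 hne
  filter_upwards [(hlim.const_mul (what i)).eventually_const_lt hpos] with k hk _
  exact hk

theorem eq_of_subgradient_of_mul_pos {a b g h : ℝ} (hab : 0 < a * b) (hg : a * g = lam * |a|)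
    (hh : b * h = lam * |b|) : g = h := by
  have key : ∀ c f : ℝ, 0 < c → c * f = lam * c → f = lam := fun c f hc hf =>
    mul_left_cancel₀ hc.ne' (by linarith)
  rcases mul_pos_iff.1 hab with ⟨ha, hb⟩ | ⟨ha, hb⟩
  · rw [abs_of_pos ha] at hg
    rw [abs_of_pos hb] at hh
    rw [key a g ha hg, key b h hb hh]
  · rw [abs_of_neg ha] at hg
    rw [abs_of_neg hb] at hh
    have h1 := key (-a) (-g) (neg_pos.2 ha) (by linarith)
    have h2 := key (-b) (-h) (neg_pos.2 hb) (by linarith)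
    linarith

/-- Once support and signs are identified, a cycle acts on the error of the fit as the successive
projections onto the hyperplanes `X_i^⊥`, `i` in the support. -/
theorem IsCoordinateDescent.eventually_sigmaNorm_le (hlam : 0 < lam)
    (hw : IsCoordinateDescent X y lam w) {what : Fin p → ℝ}
    (hwhat : IsLassoSolution X y lam what) (hcol : ∀ i, column X i ≠ 0)
    (hgen : GeneralPosition X)
    (heq : equicorrelationSet X y lam what = activeSet what) :
    ∀ᶠ k in atTop, sigmaNorm X (w (k + 1) - what) ≤
      rateBound X (activeSet what) * sigmaNorm X (w k - what) := by
  have hzero := hw.eventually_eq_zero hlam hwhat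
  have hpos := hw.eventually_mul_pos hlam hwhat hgen heq
  rw [heq] at hzero
  filter_upwards [hzero, (tendsto_add_atTop_nat 1).eventually hzero,
    (tendsto_add_atTop_nat 1).eventually hpos] with k hk hk1 hpos1
  have h := norm_le_rateBound_mul_of_successive_projections X hcol (activeSet what)
    (fun m => fit X (hybrid (w (k + 1)) (w k) m) - fit X what) (fun i hi => ?_)
    (fun i _ => ⟨w k i - w (k + 1) i, ?_⟩) (fun i hi => ?_) ?_
  · simpa only [hybrid_zero, hybrid_last, sigmaNorm_eq_norm_fit, fit_sub] using h
  · have h1 := eq_of_subgradient_of_mul_pos (hpos1 i hi)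
      ((isLassoSolution_iff hlam.le).1 hwhat i).2 (hw.kkt hlam.le k i).2
    rw [inner_sub_right, inner_sub_right] at h1
    rw [inner_sub_right]
    linarith
  · rw [← fit_hybrid_sub, sub_sub_sub_cancel_right]
  · have h1 := fit_hybrid_sub X (w (k + 1)) (w k) i
    rw [hk i hi, hk1 i hi, sub_zero, zero_smul, sub_eq_zero] at h1
    rw [h1]
  · simp only [hybrid_zero]
    rw [← fit_sub, fit_eq_sum]
    refine Submodule.sum_mem _ fun j _ => ?_
    by_cases hj : j ∈ activeSet what
    · exact Submodule.smul_mem _ _ (Submodule.subset_span ⟨j, hj, rfl⟩)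
    · have : what j = 0 := by simpa [activeSet] using hj
      simp [hk j hj, this]

end Convergence

end LassoCD

theorem mainTheorem3 (n p : ℕ) (X : Matrix (Fin n) (Fin p) ℝ) (lam : ℝ)
    (hcol : ∀ i, LassoCD.column X i ≠ 0)
    (hgen : LassoCD.GeneralPosition X)
    (hlam : 0 < lam) :
    -- the lasso solution exists and is unique, and the iterates are well defined
    (∀ y : EuclideanSpace ℝ (Fin n), ∃! what : Fin p → ℝ,
      LassoCD.IsLassoSolution X y lam what) ∧
    (∀ (y : EuclideanSpace ℝ (Fin n)) (w₀ : Fin p → ℝ), ∃! w : ℕ → Fin p → ℝ,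
      w 0 = w₀ ∧ LassoCD.IsCoordinateDescent X y lam w) ∧
    -- for almost every `y`, the equicorrelation set is the support of the solution
    (∀ᵐ y : EuclideanSpace ℝ (Fin n), ∀ what : Fin p → ℝ,
      LassoCD.IsLassoSolution X y lam what →
      LassoCD.equicorrelationSet X y lam what = LassoCD.activeSet what) ∧
    -- for every such `y`, the error bound holds for all large `k`
    (∀ (y : EuclideanSpace ℝ (Fin n)) (what : Fin p → ℝ),
      LassoCD.IsLassoSolution X y lam what →
      LassoCD.equicorrelationSet X y lam what = LassoCD.activeSet what →
      ∀ w : ℕ → Fin p → ℝ, LassoCD.IsCoordinateDescent X y lam w →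
        ∀ᶠ k : ℕ in atTop,
          LassoCD.sigmaNorm X (w (k + 1) - what) ≤
            LassoCD.rateBound X (LassoCD.activeSet what) *
              LassoCD.sigmaNorm X (w k - what)) := by
  refine ⟨fun y => LassoCD.existsUnique_isLassoSolution hgen y hlam,
    fun y w₀ => LassoCD.existsUnique_isCoordinateDescent hcol y hlam w₀,
    LassoCD.ae_equicorrelationSet_eq_activeSet hgen hlam, ?_⟩
  intro y what hwhat heq w hw
  exact hw.eventually_sigmaNorm_le hlam hwhat hcol hgen heq
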